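/- Fix infinite sets of values, of expression names and of attribute names, and a linear order on the attribute names. Expressions are built from $\emptyset$, the nullary tuple $\langle\rangle$, singletons, expression names, unions $E_1\cup\dots\cup E_m$ and products $E_1\times\dots\times E_m$ ($m\ge 1$); no operand of a union is the expression $\emptyset$. In *unnamed* expressions singletons are $\langle a\rangle$ with $a$ a value; every expression has an arity ($0$ for $\emptyset$ and $\langle\rangle$, $1$ for $\langle a\rangle$), operands of a union have equal arity, and arities add up in products. In *named* expressions singletons are $\langle A\colon a\rangle$ with $A$ an attribute name and $a$ a value; every expression has a schema, i.e. a finite set of attributes ($\emptyset$ for $\emptyset$ and $\langle\rangle$, $\{A\}$ for $\langle A\colon a\rangle$), operands of a union have equal schemas, operands of a product have pairwise disjoint schemas, and the schema of the product is their union. An *unnamed* (resp. *named*) *factorized relation*, uFR (resp. nFR), is a non-empty sequence of rules $N_1:=E_1,\dots,N_r:=E_r$ with pairwise distinct names $N_i$, where $E_i$ is an unnamed (resp. named) expression that references only names among $N_{i+1},\dots,N_r$ and has the same arity (resp. schema) as $N_i$; the start symbol is $N_1$. It represents the relation $[\![F]\!]$ obtained by evaluating the rules from the last to the first, interpreting $\times$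 as concatenation of tuples in the unnamed case and as the common extension of tuples (functions from finite sets of attributes to values) in the named case. The nFRs are also known as $d$-representations. The *size* of a factorized relation is the total number of occurrences of symbols and of operators in $E_1,\dots,E_r$, where a union or product of $m$ operands contains $m-1$ operators. For a named relation $R$, $\mathsf{unnamed}(R)$ is obtained by replacing every tuple by the list of its values in the order of the attributes. An nFR $G$ and a uFR $F$ are *equivalent* if $\mathsf{unnamed}([\![G]\!])=[\![F]\!]$. **Proposition.** 1. There are constants $C$ and $c>0$ such that for every $n\ge 1$ there is a uFR of size at most $Cn$ that has equivalent nFRs, the smallest of which has size at least $2^{cn}$. 2. There are constants $C$ and $c>0$ such that for every $n\ge 1$ there is an nFR of size at most $Cn$ that has equivalent uFRs, the smallest of which has size at least $2^{cn}$. -/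

import Mathlib

noncomputable section

/-- Relation expressions with expression names from `N`, whose singletons carry elements of `α`
(plain values in the unnamed perspective, attribute-value pairs in the named one).
Unions and products have `n + 1` operands, that is, an arbitrary positive number. -/
inductive FExpr (α N : Type*) where
  | empty : FExpr α N
  | nullary : FExpr α N
  | single (a : α) : FExpr α N
  | name (x : N) : FExpr α N
  | union (n : ℕ) (E : Fin (n + 1) → FExpr α N) : FExpr α N
  | prod (n : ℕ) (E : Fin (n + 1) → FExpr α N) : FExpr α N

namespace FExpr

variable {α N β : Type*}

/-- The number of occurrences of symbols plus the number of occurrences of the binary operator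
signs; `E₁ ∪ ⋯ ∪ Eₙ₊₁` and `E₁ × ⋯ × Eₙ₊₁` contain `n` signs at the top level. -/
def size : FExpr α N → ℕ
  | empty => 1
  | nullary => 1
  | single _ => 1
  | name _ => 1
  | union n E => n + ∑ i, (E i).size
  | prod n E => n + ∑ i, (E i).size

/-- The relation denoted by an expression, as a set of tuples of type `β`. The parameters are the
one-column tuple `sing a`, the concatenation `cat` of a list of tuples (so `cat []` is the nullary
tuple), and the relations `env x` denoted by the names. -/
def eval (sing : α → β) (cat : List β → β) (env : N → Set β) : FExpr α N → Set β
  | empty => ∅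
  | nullary => {cat []}
  | single a => {sing a}
  | name x => env x
  | union _ E => ⋃ i, (E i).eval sing cat env
  | prod _ E => {t | ∃ ts, (∀ i, ts i ∈ (E i).eval sing cat env) ∧ t = cat (List.ofFn ts)}

/-- `HasArity ar X E k`: `E` is an (unnamed) `X`-expression of arity `k`, where the names have the
arities given by `ar`. Taking a union with the expression `∅` is not allowed. -/
inductive HasArity (ar : N → ℕ) (X : Set N) : FExpr α N → ℕ → Prop
  | empty : HasArity ar X empty 0
  | nullary : HasArity ar X nullary 0
  | single (a : α) : HasArity ar X (single a) 1
  | name (x : N) : x ∈ X → HasArity ar X (name x) (ar x)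
  | union (n : ℕ) (E : Fin (n + 1) → FExpr α N) (k : ℕ) :
      (∀ i, E i ≠ FExpr.empty) → (∀ i, HasArity ar X (E i) k) → HasArity ar X (union n E) k
  | prod (n : ℕ) (E : Fin (n + 1) → FExpr α N) (k : Fin (n + 1) → ℕ) :
      (∀ i, HasArity ar X (E i) (k i)) → HasArity ar X (prod n E) (∑ i, k i)

/-- `HasSchema sch X E s`: `E` is a named `X`-expression over the set `s` of attributes, where the
names have the schemas given by `sch`. Operands of a union have equal schemas, operands of a
product have pairwise disjoint schemas. Taking a union with the expression `∅` is not allowed. -/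
inductive HasSchema {Att V : Type*} [DecidableEq Att] (sch : N → Finset Att) (X : Set N) :
    FExpr (Att × V) N → Finset Att → Prop
  | empty : HasSchema sch X empty ∅
  | nullary : HasSchema sch X nullary ∅
  | single (A : Att) (a : V) : HasSchema sch X (single (A, a)) {A}
  | name (x : N) : x ∈ X → HasSchema sch X (name x) (sch x)
  | union (n : ℕ) (E : Fin (n + 1) → FExpr (Att × V) N) (s : Finset Att) :
      (∀ i, E i ≠ FExpr.empty) → (∀ i, HasSchema sch X (E i) s) → HasSchema sch X (union n E) s
  | prod (n : ℕ) (E : Fin (n + 1) → FExpr (Att × V) N) (s : Fin (n + 1) → Finset Att) :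
      (∀ i j, i ≠ j → Disjoint (s i) (s j)) → (∀ i, HasSchema sch X (E i) (s i)) →
      HasSchema sch X (prod n E) (Finset.univ.biUnion s)

end FExpr

namespace FRules

variable {α N β : Type*}

/-- The names defined by a list of rules `x := E`. -/
def names (D : List (N × FExpr α N)) : Set N := {x | ∃ E, (x, E) ∈ D}

/-- The sum of the sizes of the right-hand sides. -/
def size (D : List (N × FExpr α N)) : ℕ := (D.map fun r => r.2.size).sum

open scoped Classical in
/-- The relations denoted by the names defined in `D`, computed from the last rule to the first. -/
def eval (sing : α → β) (cat : List β → β) : List (N × FExpr α N) → N → Set β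
  | [] => fun _ => ∅
  | (x, E) :: D => Function.update (eval sing cat D) x (E.eval sing cat (eval sing cat D))

/-- `HasType` is the typing relation of expressions, relative to the set of names that may be
referenced; `ty` gives the type (arity or schema) of each name. The names of the rules are
distinct, each right-hand side references only names of later rules, and it has the type of the
name that it defines. -/
inductive WellFormed {T : Type*} (HasType : Set N → FExpr α N → T → Prop) (ty : N → T) :
    List (N × FExpr α N) → Prop
  | nil : WellFormed HasType ty []
  | cons (x : N) (E : FExpr α N) (D : List (N × FExpr α N)) :
      x ∉ names D → HasType (names D) E (ty x) → WellFormed HasType ty D →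
      WellFormed HasType ty ((x, E) :: D)

end FRules

/-- Unnamed factorized relations with values in `V` and expression names in `N`. The list of rules
is `start := startExpr` followed by `rest`. The arity of the relation is `ar start`. -/
structure UFR (V N : Type*) where
  start : N
  startExpr : FExpr V N
  rest : List (N × FExpr V N)
  ar : N → ℕ
  wellFormed : FRules.WellFormed (FExpr.HasArity ar) ar ((start, startExpr) :: rest)

namespace UFR

variable {V N : Type*}

/-- The rules, beginning with the one of the start symbol. -/
def rules (F : UFR V N) : List (N × FExpr V N) := (F.start, F.startExpr) :: F.rest

/-- The total size of the expressions. -/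
def size (F : UFR V N) : ℕ := FRules.size F.rules

/-- The represented relation; a `k`-ary tuple is a list of length `k`. -/
def sem (F : UFR V N) : Set (List V) :=
  FRules.eval (fun a => [a]) List.flatten F.rules F.start

end UFR

/-- Tuples in the named perspective: functions from a finite set of attributes to values. -/
abbrev NamedTuple (Att V : Type*) := Finmap (fun _ : Att => V)

namespace NamedTuple

variable {Att V : Type*} [LinearOrder Att]

/-- The common extension of a list of tuples (with disjoint attribute sets). -/
def join (ts : List (NamedTuple Att V)) : NamedTuple Att V := ts.foldr (· ∪ ·) ∅

/-- The list of the values of a tuple, in the order of the attributes. -/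
def unnamed (t : NamedTuple Att V) : List V :=
  (t.keys.sort (· ≤ ·)).filterMap fun A => t.lookup A

end NamedTuple

/-- Named factorized relations (`d`-representations) with attributes in `Att`, values in `V` and
expression names in `N`. The list of rules is `start := startExpr` followed by `rest`. The schema
of the relation is `sch start`. -/
structure NFR (Att V N : Type*) [LinearOrder Att] where
  start : N
  startExpr : FExpr (Att × V) N
  rest : List (N × FExpr (Att × V) N)
  sch : N → Finset Att
  wellFormed : FRules.WellFormed (FExpr.HasSchema sch) sch ((start, startExpr) :: rest)

namespace NFR

variable {Att V N : Type*} [LinearOrder Att]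

/-- The rules, beginning with the one of the start symbol. -/
def rules (G : NFR Att V N) : List (N × FExpr (Att × V) N) := (G.start, G.startExpr) :: G.rest

/-- The total size of the expressions. -/
def size (G : NFR Att V N) : ℕ := FRules.size G.rules

/-- The represented named relation. -/
def sem (G : NFR Att V N) : Set (NamedTuple Att V) :=
  FRules.eval (fun p => Finmap.singleton p.1 p.2) NamedTuple.join G.rules G.start

/-- A named and an unnamed factorized relation are equivalent if the conversion of the former's
relation to the unnamed perspective (along the fixed order of the attributes) is the latter's. -/
def Equivalent (G : NFR Att V N) (F : UFR V N) : Prop := NamedTuple.unnamed '' G.sem = F.sem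

end NFR

end

/-! Part 1: names can be reused in unnamed products, so repeated squaring describes the single word
`a ^ (2 ^ n)` by `O(n)` symbols. In a named factorized relation every attribute of a represented
tuple must occur in a singleton of some rule, so the size is at least the tuple length `2 ^ n`
(`NFR.length_le_size`).

Part 2: the relation consists of the words `ww`, where the `i`-th letter of `w` is one of two
letters reserved for position `i`. With names, the two columns that carry the `i`-th letter can be
multiplied together whatever their distance in the attribute order, so one product of `n` small
unions suffices. Without names a product is a concatenation, as in a context-free grammar.
Decomposing a word along the products until the piece is shorter than a threshold `T` yields a
factor of length between `T / 2` and `T` that may be exchanged for any word of a language `K`, one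
of fewer than `size` many (`FRules.hasMediumFactors_eval`, `FRules.length_cuts_le_size`). For `T = n
+ 1` the rest of `ww` determines the whole word, so `K` determines the factor. The factor fixes at
least about `n / 4` letters of `w`, so each `K` serves only a `2 ^ (-n / 4)` fraction of the `2 ^ n`
words, and exponentially many `K` are needed. -/

/-! ### Lower bound for unnamed factorized relations -/

/-- The concatenation of a list of languages. -/
def concatLanguages {V : Type*} : List (Set (List V)) → Set (List V)
  | [] => {[]}
  | L :: l => Set.image2 (· ++ ·) L (concatLanguages l)

/-- Reads an `m`-fold product as iterated binary concatenation, so that its words can be cut in two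
at a time. -/
theorem setOf_flatten_ofFn_eq_concatLanguages {V : Type*} {m : ℕ} (L : Fin m → Set (List V)) :
    {t | ∃ ts : Fin m → List V, (∀ i, ts i ∈ L i) ∧ t = (List.ofFn ts).flatten} =
      concatLanguages (List.ofFn L) := by
  induction m with
  | zero => ext t; simp [concatLanguages]
  | succ m ih =>
    ext t
    simp only [List.ofFn_succ, concatLanguages, Set.mem_image2, ← ih, Set.mem_ofPred_eq]
    constructor
    · rintro ⟨ts, h, rfl⟩
      exact ⟨ts 0, h 0, _, ⟨fun i => ts i.succ, fun i => h _, rfl⟩, by simp⟩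
    · rintro ⟨u, hu, _, ⟨ts, h, rfl⟩, rfl⟩
      refine ⟨Fin.cons u ts, fun i => ?_, by simp⟩
      refine Fin.cases hu (fun j => h j) i

/-- The languages at which words of a concatenation of languages are cut into two parts, if the
languages are split off one by one. -/
def splitLanguages {V : Type*} : List (Set (List V)) → List (Set (List V))
  | [] => []
  | [_] => []
  | L :: L' :: l => L :: concatLanguages (L' :: l) :: splitLanguages (L' :: l)

theorem length_splitLanguages {V : Type*} :
    ∀ l : List (Set (List V)), (splitLanguages l).length = 2 * (l.length - 1)
  | [] => rfl
  | [_] => rfl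
  | L :: L' :: l => by
    have := length_splitLanguages (L' :: l)
    simp only [splitLanguages, List.length_cons] at *
    omega

/-- The word `y ∈ K` is a factor of `w`, and replacing it by any element of `K` leads to an element
of `L`. -/
def IsFactorIn {V : Type*} (L K : Set (List V)) (w y : List V) : Prop :=
  y ∈ K ∧ ∃ x z, w = x ++ y ++ z ∧ ∀ y' ∈ K, x ++ y' ++ z ∈ L

namespace IsFactorIn

variable {V : Type*} {L L' K M : Set (List V)} {w y u : List V}

theorem refl (h : w ∈ L) : IsFactorIn L L w w := ⟨h, [], [], by simp, by simp⟩

theorem mono (h : IsFactorIn L K w y) (hL : L ⊆ L') : IsFactorIn L' K w y := by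
  obtain ⟨hy, x, z, rfl, h⟩ := h
  exact ⟨hy, x, z, rfl, fun y' hy' => hL (h y' hy')⟩

theorem trans (h : IsFactorIn L K w y) (h' : IsFactorIn K M y u) : IsFactorIn L M w u := by
  obtain ⟨-, x, z, rfl, h⟩ := h
  obtain ⟨hu, x', z', rfl, h'⟩ := h'
  exact ⟨hu, x ++ x', z' ++ z, by simp, fun y' hy' => by simpa using h _ (h' y' hy')⟩

theorem left {v : List V} (hu : u ∈ L) (hv : v ∈ K) :
    IsFactorIn (Set.image2 (· ++ ·) L K) L (u ++ v) u :=
  ⟨hu, [], v, by simp, fun y' hy' => ⟨y', hy', v, hv, by simp⟩⟩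

theorem right {v : List V} (hu : u ∈ L) (hv : v ∈ K) :
    IsFactorIn (Set.image2 (· ++ ·) L K) K (u ++ v) v :=
  ⟨hv, u, [], by simp, fun y' hy' => ⟨u, hu, y', hy', by simp⟩⟩

end IsFactorIn

/-- Cut a long word into its first operand and the rest. If one of the two is still long, descend
into it; otherwise both are shorter than `T` and the longer one has at least half of the length.
Descent ends at a medium factor or at a single long operand. -/
theorem exists_isFactorIn_concatLanguages {V : Type*} {T : ℕ} (hT : 0 < T) :
    ∀ (l : List (Set (List V))) (w : List V), w ∈ concatLanguages l → T ≤ w.length →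
      (∃ K ∈ splitLanguages l, ∃ y, IsFactorIn (concatLanguages l) K w y ∧ y.length < T ∧
        T ≤ 2 * y.length) ∨
      ∃ K ∈ l, ∃ y, IsFactorIn (concatLanguages l) K w y ∧ T ≤ y.length
  | [], w, hw, hl => by
    obtain rfl : w = [] := hw
    simp at hl
    omega
  | [L], w, hw, hl => by
    refine Or.inr ⟨L, by simp, w, ?_, hl⟩
    have h : concatLanguages [L] = L := by ext; simp [concatLanguages]
    rw [h] at hw ⊢
    exact .refl hw
  | L :: L' :: l, w, hw, hl => by
    obtain ⟨u, hu, v, hv, rfl⟩ := hw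
    have hl : T ≤ u.length + v.length := by simpa using hl
    have hleft : IsFactorIn (concatLanguages (L :: L' :: l)) L (u ++ v) u := .left hu hv
    have hright : IsFactorIn (concatLanguages (L :: L' :: l)) (concatLanguages (L' :: l))
      (u ++ v) v := .right hu hv
    by_cases h1 : T ≤ u.length
    · exact Or.inr ⟨L, by simp, u, hleft, h1⟩
    by_cases h2 : T ≤ v.length
    · rcases exists_isFactorIn_concatLanguages hT (L' :: l) v hv h2 with
        ⟨K, hK, y, hy, h⟩ | ⟨K, hK, y, hy, h⟩
      · exact Or.inl ⟨K, by simp [splitLanguages, hK], y, hright.trans hy, h⟩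
      · exact Or.inr ⟨K, List.mem_cons_of_mem _ hK, y, hright.trans hy, h⟩
    by_cases h3 : u.length ≤ v.length
    · exact Or.inl ⟨_, by simp [splitLanguages], v, hright, by omega, by omega⟩
    · exact Or.inl ⟨L, by simp [splitLanguages], u, hleft, by omega, by omega⟩

/-- Every long word of `L` has a factor of medium length that can be replaced by all words of some
language in `S`. -/
def HasMediumFactors {V : Type*} (T : ℕ) (S : List (Set (List V))) (L : Set (List V)) : Prop :=
  ∀ w ∈ L, T ≤ w.length →
    ∃ K ∈ S, ∃ y, IsFactorIn L K w y ∧ y.length < T ∧ T ≤ 2 * y.length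

theorem HasMediumFactors.mono {V : Type*} {T : ℕ} {S S' : List (Set (List V))}
    {L : Set (List V)} (h : HasMediumFactors T S L) (hS : S ⊆ S') : HasMediumFactors T S' L :=
  fun w hw hl => let ⟨K, hK, y, hy⟩ := h w hw hl; ⟨K, hS hK, y, hy⟩

namespace FExpr

/-- The languages at which words of the (unnamed) relation denoted by an expression are cut by the
products that occur in the expression. -/
def cuts {V N : Type*} (env : N → Set (List V)) : FExpr V N → List (Set (List V))
  | empty => []
  | nullary => []
  | single _ => []
  | name _ => []
  | union _ E => (List.ofFn fun i => (E i).cuts env).flatten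
  | prod _ E => splitLanguages (List.ofFn fun i => (E i).eval (fun a => [a]) List.flatten env) ++
      (List.ofFn fun i => (E i).cuts env).flatten

/-- A product of `m` operands adds `2 * (m - 1)` cuts. These are paid for by its `m - 1` operators
and by the strictness of the inequality in each of the `m` operands, with one unit left over. -/
theorem length_cuts_lt_size {V N : Type*} (env : N → Set (List V)) (E : FExpr V N) :
    (E.cuts env).length < E.size := by
  have key : ∀ (n : ℕ) (E : Fin (n + 1) → FExpr V N),
      (∀ i, ((E i).cuts env).length < (E i).size) →
      (List.ofFn fun i => (E i).cuts env).flatten.length + (n + 1) ≤ ∑ i, (E i).size := by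
    intro n E ih
    have : ∑ i, (((E i).cuts env).length + 1) ≤ ∑ i, (E i).size := Finset.sum_le_sum fun i _ => ih i
    rw [List.length_flatten, List.map_ofFn, List.sum_ofFn]
    simpa [Finset.sum_add_distrib] using this
  induction E with
  | empty | nullary | single | name => simp [cuts, size]
  | union n E ih =>
    have := key n E ih
    simp only [cuts, size]
    omega
  | prod n E ih =>
    have := key n E ih
    simp only [cuts, size, List.length_append, length_splitLanguages, List.length_ofFn]
    omega

/-- The descent continues into the operand that holds the long factor, and exchangeability composes
by `IsFactorIn.trans`. The bound `2 ≤ T` makes singletons short. A name contributes no cuts of its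
own: those of its rule are counted there, once for all references. -/
theorem hasMediumFactors_eval {V N : Type*} {T : ℕ} (hT : 2 ≤ T) {env : N → Set (List V)}
    {S : List (Set (List V))} (henv : ∀ x, HasMediumFactors T S (env x)) (E : FExpr V N)
    (hE : E.cuts env ⊆ S) :
    HasMediumFactors T S (E.eval (fun a => [a]) List.flatten env) := by
  induction E with
  | empty => exact fun w hw => hw.elim
  | nullary =>
    rintro w hw hl
    obtain rfl : w = [] := hw
    simp at hl
    omega
  | single a =>
    rintro w hw hl
    obtain rfl : w = [a] := hw
    simp at hl
    omega
  | name x => exact henv x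
  | union n E ih =>
    intro w hw hl
    obtain ⟨i, hi⟩ := Set.mem_iUnion.1 hw
    have hsub : (E i).cuts env ⊆ S := fun K hK =>
      hE (by simp only [cuts, List.mem_flatten, List.mem_ofFn]; exact ⟨_, ⟨i, rfl⟩, hK⟩)
    obtain ⟨K, hK, y, hy, h⟩ := ih i hsub w hi hl
    exact ⟨K, hK, y, hy.mono (Set.subset_iUnion
      (fun i => (E i).eval (fun a => [a]) List.flatten env) i), h⟩
  | prod n E ih =>
    have heq : (prod n E).eval (fun a => [a]) List.flatten env = concatLanguages
        (List.ofFn fun i => (E i).eval (fun a => [a]) List.flatten env) :=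
      setOf_flatten_ofFn_eq_concatLanguages _
    intro w hw hl
    rw [heq] at hw ⊢
    rcases exists_isFactorIn_concatLanguages (by omega) _ w hw hl with
      ⟨K, hK, h⟩ | ⟨K, hK, y, hy, h⟩
    · exact ⟨K, hE (List.mem_append_left _ hK), h⟩
    · obtain ⟨i, rfl⟩ := List.mem_ofFn.1 hK
      have hsub : (E i).cuts env ⊆ S := fun K hK => hE (List.mem_append_right _
        (by simp only [List.mem_flatten, List.mem_ofFn]; exact ⟨_, ⟨i, rfl⟩, hK⟩))
      obtain ⟨K, hK, y', hy', h'⟩ := ih i hsub y hy.1 h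
      exact ⟨K, hK, y', hy.trans hy', h'⟩

end FExpr

namespace FRules

/-- The languages at which words are cut by the products that occur in a list of rules. -/
def cuts {V N : Type*} : List (N × FExpr V N) → List (Set (List V))
  | [] => []
  | (_, E) :: D => E.cuts (eval (fun a => [a]) List.flatten D) ++ cuts D

theorem length_cuts_le_size {V N : Type*} (D : List (N × FExpr V N)) :
    (cuts D).length ≤ size D := by
  induction D with
  | nil => simp [cuts]
  | cons r D ih =>
    have := r.2.length_cuts_lt_size (eval (fun a => [a]) List.flatten D)
    simp only [cuts, size, List.length_append, List.map_cons, List.sum_cons] at *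
    omega

theorem hasMediumFactors_eval {V N : Type*} {T : ℕ} (hT : 2 ≤ T) (D : List (N × FExpr V N))
    (x : N) : HasMediumFactors T (cuts D) (eval (fun a => [a]) List.flatten D x) := by
  classical
  induction D generalizing x with
  | nil => exact fun w hw => hw.elim
  | cons r D ih =>
    obtain ⟨x', E⟩ := r
    by_cases h : x = x'
    · subst h
      simp only [eval, Function.update_self]
      exact E.hasMediumFactors_eval hT
        (fun x => (ih x).mono (List.subset_append_right _ _)) (List.subset_append_left _ _)
    · simp only [eval, Function.update_of_ne h]
      exact (ih x).mono (List.subset_append_right _ _)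

end FRules

/-! ### Squares of words and the counting argument -/

/-- The word that repeats twice the sequence of the letters `f (i, s i)`. -/
def doubledWord {V : Type*} {n : ℕ} (f : Fin n × Bool → V) (s : Fin n → Bool) : List V :=
  (List.ofFn fun i => f (i, s i)) ++ List.ofFn fun i => f (i, s i)

/-- A square is determined by the part outside of a factor of at most half the length. -/
theorem eq_of_append_append_eq_append_self {V : Type*} {w w' x y y' z : List V}
    (hlen : w.length = w'.length) (hy : y.length ≤ w.length) (h : w ++ w = x ++ y ++ z)
    (h' : w' ++ w' = x ++ y' ++ z) : y = y' := by
  have hyy : y.length = y'.length := by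
    have h1 := congrArg List.length h
    have h2 := congrArg List.length h'
    simp only [List.length_append] at h1 h2
    omega
  have hw : w = w' := by
    refine List.ext_getElem? fun q => ?_
    by_cases hq : w.length ≤ q
    · rw [List.getElem?_eq_none hq, List.getElem?_eq_none (hlen ▸ hq)]
    -- The letter at `q` also stands at `w.length + q`. If `q` is not before `y`, then the second
    -- copy is after `y`, because `y` is no longer than `w`.
    by_cases hqx : q < x.length
    · have h1 : (w ++ w)[q]? = w[q]? := List.getElem?_append_left (by omega)
      have h2 : (w' ++ w')[q]? = w'[q]? := List.getElem?_append_left (by omega)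
      rw [← h1, ← h2, h, h', List.append_assoc, List.append_assoc,
        List.getElem?_append_left hqx, List.getElem?_append_left hqx]
    · have h1 : (w ++ w)[w.length + q]? = w[q]? := by
        rw [List.getElem?_append_right (by omega)]; simp
      have h2 : (w' ++ w')[w.length + q]? = w'[q]? := by
        rw [List.getElem?_append_right (by omega)]; simp [hlen]
      rw [← h1, ← h2, h, h', List.getElem?_append_right (by simp; omega),
        List.getElem?_append_right (by simp; omega)]
      simp [hyy]
  subst hw
  simpa using h.symm.trans h'

/-- Letters of different positions differ, so no letter occurs more than twice in the doubled word,
let alone in `y`. -/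
theorem length_le_two_mul_card_of_factor_doubledWord {V : Type*} [DecidableEq V] {n : ℕ}
    {f : Fin n × Bool → V} (hf : Function.Injective f) {s : Fin n → Bool} {x y z : List V}
    (h : doubledWord f s = x ++ y ++ z) :
    y.length ≤ 2 * (Finset.univ.filter fun q => f (q, s q) ∈ y).card := by
  have hg : Function.Injective fun i => f (i, s i) := fun i j hij => congrArg Prod.fst (hf hij)
  have hnd : (List.ofFn fun i => f (i, s i)).Nodup := List.nodup_ofFn.2 hg
  have hsub : y.Sublist (doubledWord f s) := by
    rw [h, List.append_assoc]
    exact (List.sublist_append_left y z).trans (List.sublist_append_right x _)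
  have hcard : y.toFinset.card ≤ (Finset.univ.filter fun q => f (q, s q) ∈ y).card := by
    refine (Finset.card_le_card (t := (Finset.univ.filter fun q => f (q, s q) ∈ y).image
      fun i => f (i, s i)) fun a ha => ?_).trans Finset.card_image_le
    have ha : a ∈ y := by simpa using ha
    have : a ∈ doubledWord f s := hsub.subset ha
    simp only [doubledWord, List.mem_append, or_self, List.mem_ofFn] at this
    obtain ⟨i, rfl⟩ := this
    simpa using ⟨i, ha, rfl⟩
  have hcount : y.length ≤ ∑ _a ∈ y.toFinset, 2 := by
    rw [← List.sum_toFinset_count_eq_length]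
    refine Finset.sum_le_sum fun a _ => (hsub.count_le a).trans ?_
    have := List.nodup_iff_count_le_one.1 hnd a
    simp only [doubledWord, List.count_append]
    omega
  simp only [Finset.sum_const, smul_eq_mul] at hcount
  omega

theorem card_filter_forall_mem_eq_le {n : ℕ} (Q : Finset (Fin n)) (s₀ : Fin n → Bool) :
    (Finset.univ.filter fun s : Fin n → Bool => ∀ q ∈ Q, s q = s₀ q).card ≤ 2 ^ (n - Q.card) := by
  have h : Fintype.card ((Qᶜ : Finset (Fin n)) → Bool) = 2 ^ (n - Q.card) := by
    simp
  rw [← h, ← Finset.card_univ]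
  refine Finset.card_le_card_of_injOn (fun s q => s q) (by simp) ?_
  intro s hs s' hs' hss
  simp only [Finset.coe_filter, Finset.mem_univ, true_and, Set.mem_ofPred_eq] at hs hs'
  funext q
  by_cases hq : q ∈ Q
  · rw [hs q hq, hs' q hq]
  · exact congrFun hss ⟨q, by simpa using hq⟩

/-- The set of all words `doubledWord f s` has no small unnamed factorized relation. -/
theorem UFR.two_pow_le_size_of_sem_eq_range_doubledWord {V N : Type*} {n : ℕ} (hn : 1 ≤ n)
    {f : Fin n × Bool → V} (hf : Function.Injective f) (F : UFR V N)
    (hF : F.sem = Set.range (doubledWord f)) : 2 ^ ((n + 3) / 4) ≤ F.size := by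
  classical
  -- With this threshold medium factors have length at most `n`, half of a doubled word, and all
  -- doubled words are long.
  have hmed := FRules.hasMediumFactors_eval (T := n + 1) (by omega) F.rules F.start
  change HasMediumFactors _ _ F.sem at hmed
  rw [hF] at hmed
  have hlen : ∀ s, (doubledWord f s).length = 2 * n := by intro s; simp [doubledWord]; omega
  choose K hKmem y hy hlt hle using fun s =>
    hmed (doubledWord f s) ⟨s, rfl⟩ (by rw [hlen]; omega)
  -- Exchanging `y s` for `y s'` yields again a doubled word with the same outer part, hence the
  -- same factor.
  have hyeq : ∀ s s', K s = K s' → y s = y s' := by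
    intro s s' hss
    obtain ⟨-, x, z, hw, hall⟩ := hy s
    obtain ⟨t, ht⟩ := hall (y s') (hss ▸ (hy s').1)
    exact eq_of_append_append_eq_append_self (by simp) (by simp; have := hlt s; omega) hw ht
  have hfiber : ∀ k ∈ (Finset.univ.image K),
      (Finset.univ.filter fun s => K s = k).card ≤ 2 ^ (n - (n + 3) / 4) := by
    intro k hk
    obtain ⟨s₀, -, rfl⟩ := Finset.mem_image.1 hk
    set Q := Finset.univ.filter fun q => f (q, s₀ q) ∈ y s₀ with hQ
    have hcard : (n + 3) / 4 ≤ Q.card := by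
      obtain ⟨-, x, z, hw, -⟩ := hy s₀
      have : (y s₀).length ≤ 2 * Q.card := by
        convert length_le_two_mul_card_of_factor_doubledWord hf hw
      have := hle s₀
      omega
    refine (Finset.card_le_card fun s hs => ?_).trans ((card_filter_forall_mem_eq_le Q s₀).trans
      (Nat.pow_le_pow_right (by norm_num) (by omega)))
    simp only [Finset.mem_filter, Finset.mem_univ, true_and] at hs ⊢
    -- The letter `f (q, s₀ q)` reveals both its position and its bit, so its occurrence in the word
    -- of `s` forces `s q = s₀ q`.
    intro q hq
    have hq : f (q, s₀ q) ∈ y s := by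
      rw [hyeq s s₀ hs]
      simpa [hQ] using hq
    obtain ⟨-, x, z, hw, -⟩ := hy s
    have : f (q, s₀ q) ∈ doubledWord f s := by rw [hw]; simp [hq]
    simp only [doubledWord, List.mem_append, or_self, List.mem_ofFn] at this
    obtain ⟨i, hi⟩ := this
    have hi := hf hi
    simp only [Prod.mk.injEq] at hi
    obtain ⟨rfl, hi⟩ := hi
    exact hi
  have hcount := Finset.card_le_mul_card_image (f := K) Finset.univ _ hfiber
  have hS : (Finset.univ.image K).card ≤ F.size := by
    refine (Finset.card_le_card (t := (FRules.cuts F.rules).toFinset) ?_).trans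
      ((List.toFinset_card_le _).trans (FRules.length_cuts_le_size _))
    intro k hk
    obtain ⟨s, -, rfl⟩ := Finset.mem_image.1 hk
    simpa using hKmem s
  have h2 : 2 ^ n = 2 ^ (n - (n + 3) / 4) * 2 ^ ((n + 3) / 4) := by
    rw [← pow_add]; congr 1; omega
  have h3 : Finset.card (Finset.univ : Finset (Fin n → Bool)) = 2 ^ n := by simp
  rw [h3, h2] at hcount
  exact (Nat.le_of_mul_le_mul_left hcount (by positivity)).trans hS

/-! ### Lower bound for named factorized relations -/

namespace FExpr

/-- The attributes that occur in a named expression. -/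
def attributes {Att V N : Type*} [DecidableEq Att] : FExpr (Att × V) N → Finset Att
  | empty => ∅
  | nullary => ∅
  | single p => {p.1}
  | name _ => ∅
  | union _ E => Finset.univ.biUnion fun i => (E i).attributes
  | prod _ E => Finset.univ.biUnion fun i => (E i).attributes

theorem card_attributes_le_size {Att V N : Type*} [DecidableEq Att] (E : FExpr (Att × V) N) :
    E.attributes.card ≤ E.size := by
  induction E with
  | empty | nullary | single | name => simp [attributes, size]
  | union n E ih | prod n E ih =>
    have := Finset.card_biUnion_le.trans (Finset.sum_le_sum fun i (_ : i ∈ Finset.univ) => ih i)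
    simp only [attributes, size]
    omega

end FExpr

namespace NamedTuple

variable {Att V : Type*} [LinearOrder Att]

theorem mem_join {ts : List (NamedTuple Att V)} {A : Att} :
    A ∈ join ts ↔ ∃ t ∈ ts, A ∈ t := by
  induction ts with
  | nil => simpa [join] using Finmap.notMem_empty
  | cons t ts ih =>
    have : join (t :: ts) = t ∪ join ts := rfl
    simp [this, ih]

theorem exists_lookup_eq_of_lookup_join_eq {ts : List (NamedTuple Att V)} {A : Att} {v : V}
    (h : (join ts).lookup A = some v) : ∃ t ∈ ts, t.lookup A = some v := by
  induction ts with
  | nil => simp [join] at h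
  | cons t ts ih =>
    have heq : join (t :: ts) = t ∪ join ts := rfl
    rw [heq] at h
    by_cases hA : A ∈ t
    · rw [Finmap.lookup_union_left hA] at h
      exact ⟨t, by simp, h⟩
    · rw [Finmap.lookup_union_right hA] at h
      obtain ⟨t', ht', h'⟩ := ih h
      exact ⟨t', by simp [ht'], h'⟩

/-- `join` prefers its first operands; as all operands that have `A` agree on it, the order does not
matter and disjointness need not be checked. -/
theorem lookup_join_eq {ts : List (NamedTuple Att V)} {A : Att} {v : V}
    (hex : ∃ t ∈ ts, A ∈ t) (h : ∀ t ∈ ts, ∀ v', t.lookup A = some v' → v' = v) :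
    (join ts).lookup A = some v := by
  obtain ⟨v', hv'⟩ := Finmap.mem_iff.1 (mem_join.2 hex)
  obtain ⟨t, ht, h'⟩ := exists_lookup_eq_of_lookup_join_eq hv'
  rw [hv', h t ht v' h']

theorem eq_and_eq_of_lookup_singleton_eq {A B : Att} {v v' : V}
    (h : (Finmap.singleton (β := fun _ => V) B v).lookup A = some v') : A = B ∧ v' = v := by
  have hA : A = B := (Finmap.mem_singleton A B v).1
    (Finmap.mem_iff (β := fun _ => V) |>.2 ⟨v', h⟩)
  subst hA
  rw [Finmap.lookup_singleton_eq] at h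
  exact ⟨rfl, (Option.some.inj h).symm⟩

/-- An increasing enumeration of the attributes of `t` is the sorted list of its keys. -/
theorem unnamed_eq_ofFn {m : ℕ} {A : Fin m → Att} (hA : StrictMono A) {v : Fin m → V}
    {t : NamedTuple Att V} (ht : ∀ i, t.lookup (A i) = some (v i))
    (ht' : ∀ B ∈ t, ∃ i, A i = B) : unnamed t = List.ofFn v := by
  have hsort : t.keys.sort (· ≤ ·) = List.ofFn A := by
    refine List.Perm.eq_of_pairwise (le := (· ≤ ·)) (fun _ _ _ _ => le_antisymm)
      (Finset.pairwise_sort _ _) ?_ ?_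
    · exact List.pairwise_ofFn.2 fun i j hij => hA.monotone hij.le
    · refine (List.perm_ext_iff_of_nodup (Finset.sort_nodup _ _)
        (List.nodup_ofFn.2 hA.injective)).2 fun B => ?_
      simp only [Finset.mem_sort, Finmap.mem_keys, List.mem_ofFn]
      exact ⟨ht' B, by rintro ⟨i, rfl⟩; exact Finmap.mem_iff.2 ⟨_, ht i⟩⟩
  have hmap : List.ofFn v = (List.ofFn A).filterMap fun B => t.lookup B := by
    simp [List.ofFn_eq_map, List.filterMap_map, ht]
  rw [unnamed, hsort, hmap]

theorem length_unnamed_le (t : NamedTuple Att V) : (unnamed t).length ≤ t.keys.card :=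
  (List.length_filterMap_le _ _).trans (by simp)

end NamedTuple

namespace FExpr

variable {Att V N : Type*} [LinearOrder Att]

theorem keys_subset_of_mem_eval {env : N → Set (NamedTuple Att V)} {B : Finset Att}
    (henv : ∀ x, ∀ t ∈ env x, t.keys ⊆ B) (E : FExpr (Att × V) N) (hE : E.attributes ⊆ B) :
    ∀ t ∈ E.eval (fun p => Finmap.singleton p.1 p.2) NamedTuple.join env, t.keys ⊆ B := by
  induction E with
  | empty => exact fun t ht => ht.elim
  | nullary =>
    rintro t ht
    obtain rfl : t = ∅ := ht
    simp
  | single p =>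
    rintro t ht
    obtain rfl : t = Finmap.singleton p.1 p.2 := ht
    simpa [attributes] using hE
  | name x => exact henv x
  | union n E ih =>
    intro t ht
    obtain ⟨i, hi⟩ := Set.mem_iUnion.1 ht
    exact ih i ((Finset.subset_biUnion_of_mem (fun i => (E i).attributes)
      (Finset.mem_univ i)).trans hE) t hi
  | prod n E ih =>
    rintro t ⟨ts, hts, rfl⟩ A hA
    rw [Finmap.mem_keys, NamedTuple.mem_join] at hA
    obtain ⟨u, hu, hA⟩ := hA
    obtain ⟨i, rfl⟩ := List.mem_ofFn.1 hu
    exact ih i ((Finset.subset_biUnion_of_mem (fun i => (E i).attributes)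
      (Finset.mem_univ i)).trans hE) _ (hts i) (Finmap.mem_keys.2 hA)

end FExpr

namespace FRules

variable {Att V N : Type*} [LinearOrder Att]

/-- `B` collects the attributes written in the singletons of all rules; references to names create
no new ones. -/
theorem exists_card_le_size_forall_keys_subset (D : List (N × FExpr (Att × V) N)) :
    ∃ B : Finset Att, B.card ≤ size D ∧ ∀ x,
      ∀ t ∈ eval (fun p => Finmap.singleton p.1 p.2) NamedTuple.join D x, t.keys ⊆ B := by
  classical
  induction D with
  | nil => exact ⟨∅, by simp, fun x t ht => ht.elim⟩
  | cons r D ih =>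
    obtain ⟨B, hB, h⟩ := ih
    obtain ⟨x', E⟩ := r
    refine ⟨E.attributes ∪ B, (Finset.card_union_le _ _).trans ?_, fun x => ?_⟩
    · have := E.card_attributes_le_size
      simp only [size, List.map_cons, List.sum_cons] at *
      omega
    · have h' : ∀ x, ∀ t ∈ eval (fun p => Finmap.singleton p.1 p.2) NamedTuple.join D x,
          t.keys ⊆ E.attributes ∪ B := fun x t ht => (h x t ht).trans Finset.subset_union_right
      by_cases hx : x = x'
      · subst hx
        simp only [eval, Function.update_self]
        exact E.keys_subset_of_mem_eval h' Finset.subset_union_left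
      · simp only [eval, Function.update_of_ne hx]
        exact h' x

end FRules

/-- A named factorized relation is at least as large as the tuples that it represents. -/
theorem NFR.length_le_size {Att V N : Type*} [LinearOrder Att] {G : NFR Att V N} {F : UFR V N}
    (h : G.Equivalent F) {w : List V} (hw : w ∈ F.sem) : w.length ≤ G.size := by
  rw [← h] at hw
  obtain ⟨t, ht, rfl⟩ := hw
  obtain ⟨B, hB, hsub⟩ := FRules.exists_card_le_size_forall_keys_subset G.rules
  exact (NamedTuple.length_unnamed_le t).trans
    ((Finset.card_le_card (hsub _ t ht)).trans hB)

/-! ### Constructions -/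

theorem exists_strictMono_fin {Att : Type*} [LinearOrder Att] [Infinite Att] (m : ℕ) :
    ∃ A : Fin m → Att, StrictMono A := by
  obtain ⟨s, hs⟩ := Infinite.exists_subset_card_eq Att m
  exact ⟨s.orderEmbOfFin hs, (s.orderEmbOfFin hs).strictMono⟩

theorem FRules.wellFormed_singleton {α N T : Type*} {HasType : Set N → FExpr α N → T → Prop}
    {ty : N → T} {x : N} {E : FExpr α N} (h : HasType (names ([] : List (N × FExpr α N))) E (ty x)) :
    WellFormed HasType ty [(x, E)] :=
  .cons x E [] (by simp [names]) h .nil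

/-- Every non-empty finite set of non-empty words of the same length has an unnamed factorized
relation. -/
theorem UFR.exists_sem_eq_range {V N ι : Type*} [Nonempty N] [Fintype ι] [Nonempty ι] {k : ℕ}
    (v : ι → Fin (k + 1) → V) :
    ∃ F : UFR V N, F.sem = Set.range fun i => List.ofFn (v i) := by
  classical
  obtain ⟨m, hm⟩ := Nat.exists_eq_succ_of_ne_zero (Fintype.card_ne_zero (α := ι))
  let e : Fin (m + 1) ≃ ι := (Fintype.equivFinOfCardEq hm).symm
  obtain ⟨x⟩ := ‹Nonempty N›
  let E : FExpr V N := .union m fun i => .prod k fun j => .single (v (e i) j)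
  have hE : FExpr.HasArity (fun _ : N => k + 1) (FRules.names ([] : List (N × FExpr V N))) E
      (k + 1) := by
    refine .union _ _ _ (fun i => by simp) fun i => ?_
    have := FExpr.HasArity.prod (ar := fun _ : N => k + 1)
      (X := FRules.names ([] : List (N × FExpr V N))) k (fun j => .single (v (e i) j)) (fun _ => 1)
      fun j => .single _
    simpa using this
  refine ⟨⟨x, E, [], fun _ => k + 1, FRules.wellFormed_singleton hE⟩, ?_⟩
  have hflat : ∀ u : Fin (k + 1) → V, (List.ofFn fun j => [u j]).flatten = List.ofFn u := by
    intro u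
    simp [List.ofFn_eq_map, ← List.flatMap_def, ← List.map_eq_flatMap]
  ext w
  simp only [sem, rules, FRules.eval, Function.update_self, E, FExpr.eval, Set.mem_iUnion,
    Set.mem_ofPred_eq, Set.mem_singleton_iff, Set.mem_range]
  constructor
  · rintro ⟨i, ts, hts, rfl⟩
    obtain rfl : ts = fun j => [v (e i) j] := funext hts
    exact ⟨e i, (hflat _).symm⟩
  · rintro ⟨i, rfl⟩
    exact ⟨e.symm i, fun j => [v i j], by simp, (hflat _).symm⟩

/-- Every set of one non-empty word has a named factorized relation. -/
theorem NFR.exists_image_unnamed_sem_eq_singleton {Att V N : Type*} [LinearOrder Att]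
    [Infinite Att] [Nonempty N] {k : ℕ} (v : Fin (k + 1) → V) :
    ∃ G : NFR Att V N, NamedTuple.unnamed '' G.sem = {List.ofFn v} := by
  obtain ⟨A, hA⟩ := exists_strictMono_fin (Att := Att) (k + 1)
  obtain ⟨x⟩ := ‹Nonempty N›
  let E : FExpr (Att × V) N := .prod k fun i => .single (A i, v i)
  have hE := FExpr.HasSchema.prod (sch := fun _ : N => Finset.univ.biUnion fun i => {A i})
    (X := FRules.names ([] : List (N × FExpr (Att × V) N))) k (fun i => .single (A i, v i))
    (fun i => {A i}) (fun i j hij => by simpa using hA.injective.ne hij) fun i => .single _ _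
  refine ⟨⟨x, E, [], _, FRules.wellFormed_singleton hE⟩, ?_⟩
  have heval : E.eval (fun p => Finmap.singleton p.1 p.2) NamedTuple.join (fun _ => ∅) =
      {NamedTuple.join (List.ofFn fun i => Finmap.singleton (A i) (v i))} := by
    ext t
    simp only [E, FExpr.eval, Set.mem_ofPred_eq, Set.mem_singleton_iff]
    constructor
    · rintro ⟨ts, hts, rfl⟩
      rw [funext hts]
    · rintro rfl
      exact ⟨_, fun i => rfl, rfl⟩
  simp only [sem, rules, FRules.eval, Function.update_self]
  rw [heval, Set.image_singleton]
  congr 1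
  refine NamedTuple.unnamed_eq_ofFn hA (fun i => NamedTuple.lookup_join_eq ?_ ?_) ?_
  · exact ⟨_, List.mem_ofFn.2 ⟨i, rfl⟩, by simp⟩
  · intro t ht v' h
    obtain ⟨j, rfl⟩ := List.mem_ofFn.1 ht
    obtain ⟨hij, rfl⟩ := NamedTuple.eq_and_eq_of_lookup_singleton_eq h
    rw [hA.injective hij]
  · intro B hB
    obtain ⟨t, ht, hB⟩ := NamedTuple.mem_join.1 hB
    obtain ⟨j, rfl⟩ := List.mem_ofFn.1 ht
    exact ⟨j, by simpa [eq_comm] using hB⟩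

/-- The rules `x n := x (n - 1) × x (n - 1), …, x 1 := x 0 × x 0, x 0 := ⟨a⟩`. -/
def squaringRules {V N : Type*} (x : ℕ → N) (a : V) : ℕ → List (N × FExpr V N)
  | 0 => [(x 0, .single a)]
  | n + 1 => (x (n + 1), .prod 1 fun _ => .name (x n)) :: squaringRules x a n

section squaringRules

variable {V N : Type*} {x : ℕ → N} {a : V}

theorem mem_names_squaringRules {n : ℕ} {y : N} :
    y ∈ FRules.names (squaringRules x a n) ↔ ∃ k ≤ n, x k = y := by
  induction n with
  | zero => simp [squaringRules, FRules.names, eq_comm]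
  | succ n ih =>
    have : y ∈ FRules.names (squaringRules x a (n + 1)) ↔
        y = x (n + 1) ∨ y ∈ FRules.names (squaringRules x a n) := by
      simp only [FRules.names, squaringRules, Set.mem_ofPred_eq, List.mem_cons, Prod.mk.injEq,
        exists_or, exists_and_left, exists_eq, and_true]
    rw [this, ih]
    constructor
    · rintro (rfl | ⟨k, hk, rfl⟩)
      exacts [⟨n + 1, le_rfl, rfl⟩, ⟨k, by omega, rfl⟩]
    · rintro ⟨k, hk, rfl⟩
      rcases Nat.le_succ_iff.1 hk with hk | rfl
      exacts [Or.inr ⟨k, hk, rfl⟩, Or.inl rfl]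

theorem size_squaringRules (n : ℕ) : FRules.size (squaringRules x a n) = 3 * n + 1 := by
  induction n with
  | zero => simp [squaringRules, FRules.size, FExpr.size]
  | succ n ih =>
    simp only [FRules.size, squaringRules, List.map_cons, List.sum_cons, FExpr.size] at ih ⊢
    simp [ih]
    ring

theorem eval_squaringRules (n : ℕ) :
    FRules.eval (fun a => [a]) List.flatten (squaringRules x a n) (x n) =
      {List.replicate (2 ^ n) a} := by
  induction n with
  | zero => simp [squaringRules, FRules.eval, FExpr.eval]
  | succ n ih =>
    ext w
    simp only [squaringRules, FRules.eval, Function.update_self, FExpr.eval, ih,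
      Set.mem_singleton_iff, Set.mem_ofPred_eq]
    constructor
    · rintro ⟨ts, hts, rfl⟩
      rw [funext hts]
      simp [List.replicate_append_replicate, pow_succ, mul_two]
    · rintro rfl
      exact ⟨_, fun i => rfl, by simp [List.replicate_append_replicate, pow_succ, mul_two]⟩

theorem wellFormed_squaringRules {ar : N → ℕ} (hx : Function.Injective x)
    (har : ∀ n, ar (x n) = 2 ^ n) (n : ℕ) :
    FRules.WellFormed (FExpr.HasArity ar) ar (squaringRules x a n) := by
  induction n with
  | zero =>
    refine FRules.wellFormed_singleton ?_
    rw [har]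
    exact .single a
  | succ n ih =>
    refine .cons _ _ _ ?_ ?_ ih
    · rw [mem_names_squaringRules]
      rintro ⟨k, hk, h⟩
      have := hx h
      omega
    · have := FExpr.HasArity.prod (α := V) (ar := ar)
        (X := FRules.names (squaringRules x a n)) 1 (fun _ => .name (x n)) _ fun _ => .name _ (mem_names_squaringRules.2 ⟨n, le_rfl, rfl⟩)
      rw [har]
      simpa [har, pow_succ, mul_comm] using this

end squaringRules

theorem UFR.exists_sem_eq_replicate_two_pow {V N : Type*} [Infinite N] (a : V) (n : ℕ) :
    ∃ F : UFR V N, F.size = 3 * n + 1 ∧ F.sem = {List.replicate (2 ^ n) a} := by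
  have hx := (Infinite.natEmbedding N).injective
  -- Arities must be given for all names; those outside the range of the embedding get an irrelevant
  -- value.
  have hwf := wellFormed_squaringRules (a := a) (ar := fun y => 2 ^ Function.invFun _ y) hx
    (fun n => by rw [Function.leftInverse_invFun hx]) n
  have hsize := size_squaringRules (x := Infinite.natEmbedding N) (a := a) n
  have heval := eval_squaringRules (x := Infinite.natEmbedding N) (a := a) n
  -- The case split only exposes the first rule of the list.
  cases n with
  | zero => exact ⟨⟨_, _, _, _, hwf⟩, hsize, heval⟩
  | succ n => exact ⟨⟨_, _, _, _, hwf⟩, hsize, heval⟩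

/-- The set of all words `doubledWord f s` has a small named factorized relation. -/
theorem NFR.exists_image_unnamed_sem_eq_range_doubledWord {Att V N : Type*} [LinearOrder Att]
    [Infinite Att] [Nonempty N] {n : ℕ} (f : Fin (n + 1) × Bool → V) :
    ∃ G : NFR Att V N, G.size = 8 * n + 7 ∧
      NamedTuple.unnamed '' G.sem = Set.range (doubledWord f) := by
  obtain ⟨A, hA⟩ := exists_strictMono_fin (Att := Att) ((n + 1) + (n + 1))
  obtain ⟨x⟩ := ‹Nonempty N›
  -- `B i j` is the attribute of the `i`-th letter in the `j`-th copy of the word.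
  let B : Fin (n + 1) → Fin 2 → Att := fun i j =>
    A (![Fin.castAdd (n + 1) i, Fin.natAdd (n + 1) i] j)
  let v : Fin (n + 1) → Fin 2 → V := fun i b => f (i, finTwoEquiv b)
  let E : FExpr (Att × V) N :=
    .prod n fun i => .union 1 fun b => .prod 1 fun j => .single (B i j, v i b)
  have hB : ∀ i j i' j', B i j = B i' j' → i = i' ∧ j = j' := by
    intro i j i' j' h
    have h := congrArg Fin.val (hA.injective h)
    have := i.2
    have := i'.2
    fin_cases j <;> fin_cases j' <;> simp [Fin.ext_iff] at h ⊢ <;> omega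
  have hsum : ∀ i b, FExpr.HasSchema
      (fun _ : N => Finset.univ.biUnion fun i => Finset.univ.biUnion fun j => {B i j})
      (FRules.names ([] : List (N × FExpr (Att × V) N)))
      (.prod 1 fun j => .single (B i j, v i b)) (Finset.univ.biUnion fun j => {B i j}) :=
    fun i b => .prod _ _ _
      (fun j j' hj => by simpa using fun h => hj (hB _ _ _ _ h).2) fun j => .single _ _
  have hE : FExpr.HasSchema
      (fun _ : N => Finset.univ.biUnion fun i => Finset.univ.biUnion fun j => {B i j})
      (FRules.names ([] : List (N × FExpr (Att × V) N))) E
      (Finset.univ.biUnion fun i => Finset.univ.biUnion fun j => {B i j}) := by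
    refine .prod _ _ _ (fun i i' hi => ?_) fun i => .union _ _ _ (fun b => by simp) (hsum i)
    rw [Finset.disjoint_left]
    intro C hC hC'
    simp only [Finset.mem_biUnion, Finset.mem_univ, true_and, Finset.mem_singleton] at hC hC'
    obtain ⟨j, rfl⟩ := hC
    obtain ⟨j', h⟩ := hC'
    exact hi (hB _ _ _ _ h).1
  refine ⟨⟨x, E, [], _, FRules.wellFormed_singleton hE⟩, ?_, ?_⟩
  · simp [size, rules, FRules.size, E, FExpr.size]
    ring
  have heval : E.eval (fun p => Finmap.singleton p.1 p.2) NamedTuple.join (fun _ => ∅) =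
      Set.range fun s : Fin (n + 1) → Bool => NamedTuple.join (List.ofFn fun i =>
        NamedTuple.join (List.ofFn fun j => Finmap.singleton (B i j) (f (i, s i)))) := by
    ext t
    simp only [E, FExpr.eval, Set.mem_ofPred_eq, Set.mem_singleton_iff, Set.mem_iUnion,
      Set.mem_range]
    constructor
    · rintro ⟨ts, hts, rfl⟩
      choose b us hus hts using hts
      refine ⟨fun i => finTwoEquiv (b i), ?_⟩
      rw [funext hts]
      congr 2
      funext i
      rw [funext (hus i)]
    · rintro ⟨s, rfl⟩
      exact ⟨_, fun i => ⟨finTwoEquiv.symm (s i), _, fun j => rfl, rfl⟩, by simp [v]⟩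
  simp only [sem, rules, FRules.eval, Function.update_self]
  rw [heval, ← Set.range_comp]
  congr 1
  funext s
  have hlookup : ∀ i j, (NamedTuple.join (List.ofFn fun i => NamedTuple.join
      (List.ofFn fun j => Finmap.singleton (B i j) (f (i, s i))))).lookup (B i j) =
        some (f (i, s i)) := by
    intro i j
    refine NamedTuple.lookup_join_eq ⟨_, List.mem_ofFn.2 ⟨i, rfl⟩,
      NamedTuple.mem_join.2 ⟨_, List.mem_ofFn.2 ⟨j, rfl⟩, by simp⟩⟩ ?_
    intro t ht v' h
    obtain ⟨i', rfl⟩ := List.mem_ofFn.1 ht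
    obtain ⟨t, ht, h⟩ := NamedTuple.exists_lookup_eq_of_lookup_join_eq h
    obtain ⟨j', rfl⟩ := List.mem_ofFn.1 ht
    obtain ⟨hij, rfl⟩ := NamedTuple.eq_and_eq_of_lookup_singleton_eq h
    rw [(hB _ _ _ _ hij).1]
  have happend : doubledWord f s =
      List.ofFn (Fin.append (fun i => f (i, s i)) fun i => f (i, s i)) := by
    rw [List.ofFn_fin_append, doubledWord]
  rw [Function.comp_apply, happend]
  refine NamedTuple.unnamed_eq_ofFn hA (fun i => ?_) fun C hC => ?_
  · refine Fin.addCases (fun i => ?_) (fun i => ?_) i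
    · rw [Fin.append_left]
      exact hlookup i 0
    · rw [Fin.append_right]
      exact hlookup i 1
  · obtain ⟨t, ht, hC⟩ := NamedTuple.mem_join.1 hC
    obtain ⟨i, rfl⟩ := List.mem_ofFn.1 ht
    obtain ⟨t, ht, hC⟩ := NamedTuple.mem_join.1 hC
    obtain ⟨j, rfl⟩ := List.mem_ofFn.1 ht
    rw [Finmap.mem_singleton] at hC
    exact ⟨_, hC.symm⟩

theorem exists_isLeast_and_le {s : Set ℕ} (hs : s.Nonempty) {r : ℝ} (h : ∀ k ∈ s, r ≤ (k : ℝ)) :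
    ∃ m : ℕ, IsLeast s m ∧ r ≤ m :=
  ⟨sInf s, ⟨Nat.sInf_mem hs, fun _ hk => Nat.sInf_le hk⟩, h _ (Nat.sInf_mem hs)⟩

theorem mainTheorem4 {V Att N : Type*} [Infinite V] [Infinite N] [Infinite Att]
    [LinearOrder Att] :
    (∃ C c : ℝ, 0 < c ∧ ∀ n : ℕ, 1 ≤ n → ∃ F : UFR V N, (F.size : ℝ) ≤ C * n ∧
      ∃ m : ℕ, IsLeast {s : ℕ | ∃ G : NFR Att V N, G.Equivalent F ∧ G.size = s} m ∧
        (2 : ℝ) ^ (c * n) ≤ m) ∧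
    (∃ C c : ℝ, 0 < c ∧ ∀ n : ℕ, 1 ≤ n → ∃ G : NFR Att V N, (G.size : ℝ) ≤ C * n ∧
      ∃ m : ℕ, IsLeast {s : ℕ | ∃ F : UFR V N, G.Equivalent F ∧ F.size = s} m ∧
        (2 : ℝ) ^ (c * n) ≤ m) := by
  -- The sizes are `3 * n + 1 ≤ 4 * n` and `8 * (n - 1) + 7 ≤ 8 * n`; the lower bounds are `2 ^ n`
  -- and `2 ^ ((n + 3) / 4)`, where the rounded quotient is at least `n / 4`.
  refine ⟨⟨4, 1, one_pos, fun n hn => ?_⟩, ⟨8, 1 / 4, by norm_num, fun n hn => ?_⟩⟩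
  · obtain ⟨a⟩ := (inferInstance : Nonempty V)
    obtain ⟨F, hsize, hF⟩ := UFR.exists_sem_eq_replicate_two_pow (N := N) a n
    obtain ⟨k, hk⟩ := Nat.exists_eq_succ_of_ne_zero (pow_ne_zero n (two_ne_zero (α := ℕ)))
    obtain ⟨G, hG⟩ := NFR.exists_image_unnamed_sem_eq_singleton (Att := Att) (N := N)
      fun _ : Fin (k + 1) => a
    refine ⟨F, ?_, exists_isLeast_and_le ?_ ?_⟩
    · rw [hsize]
      have : (1 : ℝ) ≤ n := by exact_mod_cast hn
      push_cast
      linarith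
    · refine ⟨_, G, ?_, rfl⟩
      rw [NFR.Equivalent, hG, hF, hk, List.ofFn_const]
    · rintro _ ⟨G, hG, rfl⟩
      have := NFR.length_le_size hG (w := List.replicate (2 ^ n) a) (by simp [hF])
      rw [List.length_replicate] at this
      rw [one_mul, Real.rpow_natCast]
      exact_mod_cast this
  · obtain ⟨k, rfl⟩ := Nat.exists_eq_add_of_le' hn
    let f : Fin (k + 1) × Bool ↪ V :=
      (Fintype.equivFin _).toEmbedding.trans (Fin.valEmbedding.trans (Infinite.natEmbedding V))
    obtain ⟨G, hsize, hG⟩ := NFR.exists_image_unnamed_sem_eq_range_doubledWord (Att := Att)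
      (N := N) f
    -- Some equivalent unnamed factorized relation must exist for a smallest one to exist; listing
    -- all words is enough. This `k` makes the word length `k + 1 + (k + 1)` definitionally.
    obtain ⟨F, hF⟩ := UFR.exists_sem_eq_range (N := N) (k := k + 1 + k)
      fun (s : Fin (k + 1) → Bool) =>
        (Fin.append (fun i => f (i, s i)) fun i => f (i, s i) : Fin (k + 1 + (k + 1)) → V)
    refine ⟨G, ?_, exists_isLeast_and_le ?_ ?_⟩
    · rw [hsize]
      push_cast
      linarith
    · refine ⟨_, F, ?_, rfl⟩
      rw [NFR.Equivalent, hG, hF]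
      congr 1
      funext s
      exact (List.ofFn_fin_append _ _).symm
    · rintro _ ⟨F, hF, rfl⟩
      have := F.two_pow_le_size_of_sem_eq_range_doubledWord hn f.injective (hF.symm.trans hG)
      refine le_trans ?_ (Nat.cast_le.2 this)
      rw [Nat.cast_pow, Nat.cast_ofNat, ← Real.rpow_natCast]
      refine Real.rpow_le_rpow_of_exponent_le one_le_two ?_
      have : k + 1 ≤ 4 * ((k + 1 + 3) / 4) := by omega
      have : ((k + 1 : ℕ) : ℝ) ≤ 4 * ((k + 1 + 3) / 4 : ℕ) := by exact_mod_cast this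
      linarith
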